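/- Let $k:\mathbb{R}^d\times\mathbb{R}^d\to\mathbb{R}$ be a measurable positive-definite kernel (symmetric, with positive semidefinite finite Gram matrices) such that $|k(x,x)|\le 1$ for all $x\in\mathbb{R}^d$, let $\mathcal{H}$ be its reproducing kernel Hilbert space, and for probability measures $\mu_1,\mu_2$ on $\mathbb{R}^d$ let $$\mathcal{D}_{\mathrm{MMD}}(\mu_1,\mu_2)=\sup_{\|f\|_{\mathcal{H}}\le 1}\Bigl|\int f\,d\mu_1-\int f\,d\mu_2\Bigr|.$$ Let $\{\mu_\theta:\theta\in\Theta\}$, $\Theta\subseteq\mathbb{R}^p$, be a statistical model of probability measures on $\mathbb{R}^d$ (depending measurably on $\theta$), let $\pi$ be a prior probability measure on $\Theta$, let $\mu^*$ be any probability measure on $\mathbb{R}^d$, and put $\varepsilon^*=\inf_{\theta\in\Theta}\mathcal{D}_{\mathrm{MMD}}(\mu_\theta,\mu^*)$. For data $y_{1:n}=(y_1,\dots,y_n)$ and a threshold $\varepsilon\ge 0$, the ABC posterior is the probability measure $$\pi_n^{(\varepsilon)}(d\theta)=\frac{1}{p_n}\,\mu_\theta^{n}\bigl(\{z_{1:n}:\mathcal{D}_{\mathrm{MMD}}(\hat\mu_{z_{1:n}},\hat\mu_{y_{1:n}})\le\varepsilon\}\bigr)\,\pi(d\theta),\qquad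 \hat\mu_{x_{1:n}}=\frac1n\sum_{i=1}^n\delta_{x_i},$$ where $p_n$, the acceptance probability, is the normalizing constant; it is well defined when $p_n>0$. Assume that (I) the observed data $y_1,y_2,\dots$ are i.i.d. from $\mu^*$; (II) $L>0$ and $c_\pi>0$ are constants such that, for all sufficiently small $\bar\varepsilon>0$, $\pi(\{\theta:\mathcal{D}_{\mathrm{MMD}}(\mu_\theta,\mu^*)\le\varepsilon^*+\bar\varepsilon\})\ge c_\pi\bar\varepsilon^{L}$. Then, with $\bar\varepsilon_n=(\log n/n)^{1/2}$, the probability, with respect to $y_{1:n}$, of the event that the ABC posterior $\pi_n^{(\varepsilon^*+\bar\varepsilon_n)}$ is well defined and satisfies $$\pi_n^{(\varepsilon^*+\bar\varepsilon_n)}\Bigl(\Bigl\{\theta:\mathcal{D}_{\mathrm{MMD}}(\mu_\theta,\mu^*)>\varepsilon^*+\Bigl[\frac{10}{3}+(L+2)^{1/2}\Bigr]\Bigl[\frac{\log n}{n}\Bigr]^{1/2}\Bigr\}\Bigr)\le\frac{2\cdot 3^{L}}{c_\pi n}$$ tends to $1$ as $n\to\infty$. -/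

import Mathlib

open MeasureTheory ProbabilityTheory Filter Topology
open scoped ENNReal

noncomputable section

namespace ABC

/-- The integral probability semimetric `sup_{f ∈ F} |∫ f dμ₁ - ∫ f dμ₂|` associated with a class
`F` of (measurable, bounded) real functions, as an element of `[0, ∞]`. -/
def ips {X : Type*} [MeasurableSpace X] (F : Set (X → ℝ)) (μ₁ μ₂ : Measure X) : ℝ≥0∞ :=
  ⨆ f ∈ F, ENNReal.ofReal |∫ x, f x ∂μ₁ - ∫ x, f x ∂μ₂|

/-- A real kernel, seen as a kernel with values in the operators on the Hilbert space `ℝ`. -/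
def opKernel {X : Type*} (k : X → X → ℝ) : Matrix X X (ℝ →L[ℝ] ℝ) :=
  Matrix.of fun x x' => k x x' • ContinuousLinearMap.id ℝ ℝ

theorem opKernel_posSemidef {X : Type*} {k : X → X → ℝ} (hk : (Matrix.of k).PosSemidef) :
    (opKernel k).PosSemidef := by
  have tfae := (RKHS.posSemidef_tfae (K := opKernel k)).out 0 2
  refine tfae.mpr ⟨?_, fun v => ?_⟩
  · ext x y
    have h := hk.1.apply x y
    simp only [Matrix.of_apply, star_trivial] at h
    have h1 : star (ContinuousLinearMap.id ℝ ℝ) = ContinuousLinearMap.id ℝ ℝ :=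
      star_one (ℝ →L[ℝ] ℝ)
    simp [opKernel, Matrix.conjTranspose_apply, h, h1]
  · have h := hk.2 v
    simp only [Matrix.of_apply, star_trivial] at h
    refine h.trans_eq ?_
    simp only [opKernel, Matrix.of_apply, RCLike.re_to_real]
    rw [Finsupp.sum_comm]
    refine Finsupp.sum_congr fun x _ => Finsupp.sum_congr fun y _ => ?_
    simp
    ring

/-- The functions in the closed unit ball of a reproducing kernel Hilbert space `H` on `X`. -/
def unitBall {X : Type*} (H : Type*) [NormedAddCommGroup H] [InnerProductSpace ℝ H]
    [RKHS ℝ H X ℝ] : Set (X → ℝ) :=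
  {f | ∃ h : H, ‖h‖ ≤ 1 ∧ ⇑h = f}

/-- Maximum mean discrepancy: the integral probability semimetric of the unit ball of the
reproducing kernel Hilbert space with kernel `k`, where `k` is a symmetric kernel all of whose
finite Gram matrices are positive semidefinite. -/
def mmd {X : Type*} [MeasurableSpace X] {k : X → X → ℝ} (hk : (Matrix.of k).PosSemidef)
    (μ₁ μ₂ : Measure X) : ℝ≥0∞ :=
  haveI : Fact (opKernel k).PosSemidef := ⟨opKernel_posSemidef hk⟩
  ips (unitBall (RKHS.OfKernel (opKernel k))) μ₁ μ₂

/-- The empirical distribution `n⁻¹ ∑ᵢ δ_{xᵢ}` of a sample of size `n`. -/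
def empirical {X : Type*} [MeasurableSpace X] {n : ℕ} (x : Fin n → X) : Measure X :=
  (n : ℝ≥0∞)⁻¹ • ∑ i, Measure.dirac (x i)

section Posterior

variable {T X : Type*} [MeasurableSpace T] [MeasurableSpace X]

/-- The lowest discrepancy between a member of the model and the data generating process. -/
def minDiscrepancy (D : Measure X → Measure X → ℝ≥0∞) (μ : Kernel T X) (μstar : Measure X) :
    ℝ≥0∞ :=
  ⨅ θ, D (μ θ) μstar

/-- The probability that an i.i.d. synthetic sample `z` of size `n` from `μ θ` is accepted,
i.e. that its empirical distribution is within discrepancy `ε` of that of the observed `y`. -/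
def acceptAt (D : Measure X → Measure X → ℝ≥0∞) (μ : Kernel T X) (ε : ℝ≥0∞) {n : ℕ}
    (y : Fin n → X) (θ : T) : ℝ≥0∞ :=
  Measure.pi (fun _ : Fin n => μ θ) {z | D (empirical z) (empirical y) ≤ ε}

/-- The overall acceptance probability of rejection ABC (the normalizing constant). -/
def acceptProb (D : Measure X → Measure X → ℝ≥0∞) (μ : Kernel T X) (prior : Measure T)
    (ε : ℝ≥0∞) {n : ℕ} (y : Fin n → X) : ℝ≥0∞ :=
  ∫⁻ θ, acceptAt D μ ε y θ ∂prior

/-- The ABC posterior with threshold `ε`; meaningful when `acceptProb` is positive. -/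
def posterior (D : Measure X → Measure X → ℝ≥0∞) (μ : Kernel T X) (prior : Measure T)
    (ε : ℝ≥0∞) {n : ℕ} (y : Fin n → X) : Measure T :=
  (acceptProb D μ prior ε y)⁻¹ • prior.withDensity (acceptAt D μ ε y)

end Posterior

end ABC

end

/-! The kernel's feature map φ takes values in the unit ball of the RKHS, and the MMD is the
distance between mean embeddings. Everything thus reduces to how far the mean of n i.i.d. features
lies from its expectation in a Hilbert space. Two estimates carry the proof. The mean squared error
is at most 1/n, giving Chebyshev's inequality; McDiarmid's inequality bounds the probability of
exceeding √(1/n) + t by exp(-n t²/2).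

Put r = √(log n / n). Chebyshev places the observed mean within r/3 of the embedding of `μstar` with
probability at least 1 - 9/log n. On this event, a parameter within ε* + r/3 of `μstar` is accepted
with probability at least 1/2 (`half_le_acceptAt`), so the prior mass condition at r/3 gives p_n ≥ c
(r/3)^L / 2. A parameter farther than ε* + (10/3 + √(L+2)) r is accepted with probability at most
exp(-(L+2) log n / 2) = n^(-1-L/2) (`acceptAt_le`). Since r^L ≥ n^(-L/2), the quotient is at most
2·3^L/(c n). -/

noncomputable section

open scoped RealInnerProductSpace

/-! ### McDiarmid's inequality -/

/-- A function of finitely many variables has differences bounded by `c` if changing one variable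
changes its value by at most `c`. -/
def HasBoundedDifferences {ι X : Type*} (f : (ι → X) → ℝ) (c : ℝ) : Prop :=
  ∀ (z z' : ι → X) (i : ι), (∀ j, j ≠ i → z j = z' j) → |f z - f z'| ≤ c

theorem piFinSuccAbove_zero_symm_eq_cons {X : Type*} [MeasurableSpace X] {n : ℕ} :
    ⇑(MeasurableEquiv.piFinSuccAbove (fun _ : Fin (n + 1) => X) 0).symm =
      fun q : X × (Fin n → X) => (Fin.cons q.1 q.2 : Fin (n + 1) → X) :=
  funext fun q => Fin.insertNth_zero' q.1 q.2

theorem measurableEmbedding_fin_cons {X : Type*} [MeasurableSpace X] {n : ℕ} :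
    MeasurableEmbedding fun q : X × (Fin n → X) => (Fin.cons q.1 q.2 : Fin (n + 1) → X) :=
  piFinSuccAbove_zero_symm_eq_cons (X := X) ▸ MeasurableEquiv.measurableEmbedding _

theorem measurePreserving_fin_cons {X : Type*} [MeasurableSpace X] (ν : Measure X) [SigmaFinite ν]
    (n : ℕ) :
    MeasurePreserving (fun q : X × (Fin n → X) => (Fin.cons q.1 q.2 : Fin (n + 1) → X))
      (ν.prod (Measure.pi fun _ => ν)) (Measure.pi fun _ => ν) :=
  piFinSuccAbove_zero_symm_eq_cons (X := X) ▸
    (measurePreserving_piFinSuccAbove (fun _ : Fin (n + 1) => ν) 0).symm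

theorem integral_pi_fin_succ {X : Type*} [MeasurableSpace X] {ν : Measure X} [SigmaFinite ν]
    {n : ℕ} (F : (Fin (n + 1) → X) → ℝ) :
    ∫ z, F z ∂Measure.pi (fun _ => ν) =
      ∫ q : X × (Fin n → X), F (Fin.cons q.1 q.2) ∂ν.prod (Measure.pi fun _ => ν) :=
  ((measurePreserving_fin_cons ν n).integral_comp measurableEmbedding_fin_cons F).symm

theorem integrable_of_abs_le {X : Type*} [MeasurableSpace X] {ν : Measure X} [IsFiniteMeasure ν]
    {f : X → ℝ} (hf : Measurable f) {B : ℝ} (hB : ∀ x, |f x| ≤ B) : Integrable f ν :=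
  Integrable.of_bound hf.aestronglyMeasurable B (ae_of_all _ hB)

/-- Hoeffding's lemma for a bounded function whose oscillation is at most `c`. -/
theorem hasSubgaussianMGF_of_forall_abs_sub_le {X : Type*} [MeasurableSpace X] {ν : Measure X}
    [IsProbabilityMeasure ν] {g : X → ℝ} (hg : Measurable g) {c : NNReal}
    (hc : ∀ x x', |g x - g x'| ≤ c) :
    HasSubgaussianMGF (fun x => g x - ∫ x, g x ∂ν) ((c / 2) ^ 2) ν := by
  obtain ⟨x₀⟩ : Nonempty X := nonempty_of_isProbabilityMeasure ν
  have hbdd : BddBelow (Set.range g) :=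
    ⟨g x₀ - c, by rintro _ ⟨x, rfl⟩; linarith [(abs_le.1 (hc x₀ x)).2]⟩
  have : Nonempty X := ⟨x₀⟩
  -- An oscillation of at most `c` confines `g` to the interval from its infimum to its infimum plus
  -- `c`.
  have h := hasSubgaussianMGF_of_mem_Icc (μ := ν) (X := g) (a := ⨅ x, g x) (b := (⨅ x, g x) + c)
    hg.aemeasurable (ae_of_all _ fun x => ⟨ciInf_le hbdd x, ?_⟩)
  · simpa using h
  · have : g x - c ≤ ⨅ x, g x := le_ciInf fun x' => by linarith [(abs_le.1 (hc x x')).2]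
    linarith

/-- McDiarmid's inequality, as a bound on the moment generating function. -/
theorem HasBoundedDifferences.hasSubgaussianMGF {X : Type*} [MeasurableSpace X] {ν : Measure X}
    [IsProbabilityMeasure ν] {c : NNReal} {B : ℝ} {n : ℕ} {f : (Fin n → X) → ℝ}
    (hf : Measurable f) (hB : ∀ z, |f z| ≤ B) (hc : HasBoundedDifferences f c) :
    HasSubgaussianMGF (fun z => f z - ∫ z, f z ∂Measure.pi fun _ => ν) (n * (c / 2) ^ 2)
      (Measure.pi fun _ => ν) := by
  have hint : ∀ {n : ℕ} {f : (Fin n → X) → ℝ} (_ : Measurable f) (_ : ∀ z, |f z| ≤ B) (t : ℝ),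
      Integrable (fun z => Real.exp (t * (f z - ∫ z, f z ∂Measure.pi fun _ => ν)))
        (Measure.pi fun _ => ν) := by
    intro n f hf hB t
    refine integrable_exp_mul_of_mem_Icc (a := -B - ∫ z, f z ∂Measure.pi fun _ => ν)
      (b := B - ∫ z, f z ∂Measure.pi fun _ => ν) (by fun_prop) (ae_of_all _ fun z => ?_)
    have := abs_le.1 (hB z)
    constructor <;> linarith
  induction n with
  | zero =>
    have h0 : ∀ z, f z - ∫ z, f z ∂(Measure.pi fun _ : Fin 0 => ν) = 0 := by
      intro z
      have : ∀ z', f z' = f z := fun z' => congrArg f (Subsingleton.elim _ _)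
      simp [this]
    simp only [h0]
    simp
  | succ n ih =>
    set π := Measure.pi (fun _ : Fin n => ν) with hπ
    have hfm : Measurable fun q : X × (Fin n → X) => f (Fin.cons q.1 q.2) :=
      hf.comp measurableEmbedding_fin_cons.measurable
    have hfx (x : X) : Measurable fun z : Fin n → X => f (Fin.cons x z) :=
      hfm.comp measurable_prodMk_left
    -- The conditional mean given the first coordinate. The deviation of `f` splits into that of `f
    -- (Fin.cons x ·)` from `g x`, handled by induction, and that of `g` from its mean, handled by
    -- Hoeffding's lemma.
    set g : X → ℝ := fun x => ∫ z, f (Fin.cons x z) ∂π with hg_def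
    have hg : Measurable g := hfm.stronglyMeasurable.integral_prod_right.measurable
    have hEf : ∫ z, f z ∂(Measure.pi fun _ : Fin (n + 1) => ν) = ∫ x, g x ∂ν := by
      rw [integral_pi_fin_succ, integral_prod]
      exact integrable_of_abs_le hfm fun q => hB _
    have hgc : ∀ x x', |g x - g x'| ≤ c := by
      intro x x'
      rw [hg_def]
      dsimp only
      rw [← integral_sub (integrable_of_abs_le (hfx x) fun _ => hB _)
        (integrable_of_abs_le (hfx x') fun _ => hB _)]
      have := norm_integral_le_of_norm_le_const (μ := π)
        (f := fun z => f (Fin.cons x z) - f (Fin.cons x' z)) (C := c) (ae_of_all _ fun z => ?_)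
      · simpa using this
      · refine hc _ _ 0 fun j hj => ?_
        obtain ⟨k, rfl⟩ := Fin.exists_succ_eq.2 hj
        simp
    have hgsub := hasSubgaussianMGF_of_forall_abs_sub_le (ν := ν) hg hgc
    refine ⟨hint hf hB, fun t => ?_⟩
    have hI := hint hf hB t
    have hIp : Integrable (fun q : X × (Fin n → X) => Real.exp (t *
        (f (Fin.cons q.1 q.2) - ∫ z, f z ∂Measure.pi fun _ => ν))) (ν.prod π) :=
      ((measurePreserving_fin_cons ν n).integrable_comp_emb measurableEmbedding_fin_cons).2 hI
    rw [mgf, integral_pi_fin_succ, integral_prod _ hIp]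
    calc _ ≤ ∫ x, Real.exp (t * (g x - ∫ x, g x ∂ν)) *
          Real.exp ((n * (c / 2) ^ 2 : NNReal) * t ^ 2 / 2) ∂ν := by
          refine integral_mono hIp.integral_prod_left
            ((hgsub.integrable_exp_mul t).mul_const _) fun x => ?_
          have hx := (ih (hfx x) (fun _ => hB _) (fun z z' i h => hc _ _ i.succ fun j => ?_)).mgf_le t
          · dsimp only
            refine le_trans (le_of_eq ?_) (mul_le_mul_of_nonneg_left hx (Real.exp_nonneg _))
            rw [mgf, ← integral_const_mul]
            refine integral_congr_ae (ae_of_all _ fun z => ?_)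
            dsimp only
            rw [← Real.exp_add, hEf, hg_def]
            congr 1
            ring
          · refine Fin.cases (fun _ => by simp) (fun k hk => ?_) j
            simpa using h k fun e => hk (by rw [e])
      _ = mgf (fun x => g x - ∫ x, g x ∂ν) ν t *
          Real.exp ((n * (c / 2) ^ 2 : NNReal) * t ^ 2 / 2) := integral_mul_const _ _
      _ ≤ Real.exp (((c / 2) ^ 2 : NNReal) * t ^ 2 / 2) *
          Real.exp ((n * (c / 2) ^ 2 : NNReal) * t ^ 2 / 2) :=
          mul_le_mul_of_nonneg_right (hgsub.mgf_le t) (Real.exp_nonneg _)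
      _ = _ := by
          rw [← Real.exp_add]
          congr 1
          push_cast
          ring

/-! ### Concentration of sample means in a Hilbert space -/

section FeatureMap

variable {X H : Type*} [MeasurableSpace X] [NormedAddCommGroup H] [InnerProductSpace ℝ H]

/-- A weakly measurable feature map into the unit ball of a Hilbert space (not assumed to be
separable) whose kernel is jointly measurable. -/
structure IsBoundedFeatureMap (φ : X → H) : Prop where
  norm_le : ∀ x, ‖φ x‖ ≤ 1
  measurable_inner : ∀ h, Measurable fun x => ⟪φ x, h⟫
  measurable_kernel : Measurable fun q : X × X => ⟪φ q.1, φ q.2⟫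

/-- `m` is the mean embedding of `ν` in the weak (Pettis) sense. -/
def IsWeakMean (φ : X → H) (ν : Measure X) (m : H) : Prop :=
  ∀ h, ⟪m, h⟫ = ∫ x, ⟪φ x, h⟫ ∂ν

/-- The average of the features of a sample. -/
def sampleMean (φ : X → H) {n : ℕ} (z : Fin n → X) : H :=
  (n : ℝ)⁻¹ • ∑ i, φ (z i)

namespace IsBoundedFeatureMap

variable {φ : X → H} (hφ : IsBoundedFeatureMap φ)
include hφ

theorem abs_inner_le (x : X) (h : H) : |⟪φ x, h⟫| ≤ ‖h‖ :=
  (abs_real_inner_le_norm _ _).trans (mul_le_of_le_one_left (norm_nonneg _) (hφ.norm_le x))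

theorem integrable_inner (ν : Measure X) [IsFiniteMeasure ν] (h : H) :
    Integrable (fun x => ⟪φ x, h⟫) ν :=
  integrable_of_abs_le (hφ.measurable_inner h) fun x => hφ.abs_inner_le x h

/-- Riesz representation of h ↦ ∫ ⟪φ x, h⟫. The weak integral requires no strong measurability of
`φ`, which could fail in a nonseparable space. -/
theorem exists_isWeakMean [CompleteSpace H] (ν : Measure X) [IsFiniteMeasure ν] :
    ∃ m, IsWeakMean φ ν m := by
  let T : H →ₗ[ℝ] ℝ :=
    { toFun := fun h => ∫ x, ⟪φ x, h⟫ ∂ν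
      map_add' := fun a b => by
        simp only [inner_add_right]
        exact integral_add (hφ.integrable_inner ν a) (hφ.integrable_inner ν b)
      map_smul' := fun c a => by
        simp only [inner_smul_right, RingHom.id_apply, smul_eq_mul]
        exact integral_const_mul _ _ }
  let T' : H →L[ℝ] ℝ := T.mkContinuous (ν.real Set.univ) fun h => by
    refine (norm_integral_le_of_norm_le_const (ae_of_all _ fun x => ?_)).trans_eq (mul_comm _ _)
    exact hφ.abs_inner_le x h
  exact ⟨(InnerProductSpace.toDual ℝ H).symm T', fun h => InnerProductSpace.toDual_symm_apply⟩

theorem norm_le_one_of_isWeakMean {ν : Measure X} [IsProbabilityMeasure ν] {m : H}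
    (hm : IsWeakMean φ ν m) : ‖m‖ ≤ 1 := by
  have h : ‖m‖ * ‖m‖ ≤ ‖m‖ := by
    rw [← real_inner_self_eq_norm_mul_norm, hm m]
    refine (le_abs_self _).trans ?_
    simpa using norm_integral_le_of_norm_le_const (μ := ν) (f := fun x => ⟪φ x, m⟫) (C := ‖m‖)
      (ae_of_all _ fun x => hφ.abs_inner_le x m)
  by_contra! h1
  nlinarith

theorem norm_sampleMean_le {n : ℕ} (z : Fin n → X) : ‖sampleMean φ z‖ ≤ 1 := by
  rw [sampleMean, norm_smul, norm_inv, Real.norm_natCast]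
  refine (mul_le_mul_of_nonneg_left ((norm_sum_le _ _).trans
    (Finset.sum_le_sum fun i _ => hφ.norm_le (z i))) (by positivity)).trans ?_
  -- This covers `n = 0` too, where the inverse is 0.
  simpa using inv_mul_le_one (a := (n : ℝ))

theorem norm_sampleMean_sub_le {n : ℕ} (z : Fin n → X) {m : H} (hm : ‖m‖ ≤ 1) :
    ‖sampleMean φ z - m‖ ≤ 2 := by
  linarith [norm_sub_le (sampleMean φ z) m, hφ.norm_sampleMean_le z]

/-- Replacing one observation moves the mean by 1/n times a difference of two vectors of the unit
ball. -/
theorem hasBoundedDifferences {n : ℕ} (m : H) :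
    HasBoundedDifferences (fun z : Fin n → X => ‖sampleMean φ z - m‖) (2 / n) := by
  intro z z' i h
  refine (abs_norm_sub_norm_le _ _).trans ?_
  rw [sub_sub_sub_cancel_right, sampleMean, sampleMean, ← smul_sub, ← Finset.sum_sub_distrib,
    Finset.sum_eq_single i (fun j _ hj => by rw [h j hj, sub_self]) (by simp), norm_smul,
    norm_inv, Real.norm_natCast, div_eq_inv_mul]
  refine mul_le_mul_of_nonneg_left ?_ (by positivity)
  linarith [norm_sub_le (φ (z i)) (φ (z' i)), hφ.norm_le (z i), hφ.norm_le (z' i)]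

/-- Without separability, measurability of the norm is read off from the expansion of its square
into kernel values and inner products with `m`. -/
theorem measurable_norm_sampleMean_sub {n : ℕ} (m : H) :
    Measurable fun z : Fin n → X => ‖sampleMean φ z - m‖ := by
  have h : (fun z : Fin n → X => ‖sampleMean φ z - m‖) = fun z => √((n : ℝ)⁻¹ * ((n : ℝ)⁻¹ *
      ∑ i, ∑ j, ⟪φ (z i), φ (z j)⟫) - 2 * ((n : ℝ)⁻¹ * ∑ i, ⟪φ (z i), m⟫) + ‖m‖ ^ 2) := by
    funext z
    rw [← Real.sqrt_sq (norm_nonneg (sampleMean φ z - m)), norm_sub_sq_real,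
      ← real_inner_self_eq_norm_sq (sampleMean φ z)]
    simp only [sampleMean, real_inner_smul_left, real_inner_smul_right, sum_inner, inner_sum,
      ← Finset.mul_sum]
    rw [Finset.sum_comm]
  rw [h]
  refine Measurable.sqrt (Measurable.add_const (Measurable.sub (Measurable.const_mul
    (Measurable.const_mul ?_ _) _) (Measurable.const_mul (Measurable.const_mul ?_ _) _)) _)
  · refine Finset.measurable_sum _ fun i _ => Finset.measurable_sum _ fun j _ => ?_
    have hp : Measurable fun z : Fin n → X => (z i, z j) := by fun_prop
    exact hφ.measurable_kernel.comp hp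
  · exact Finset.measurable_sum _ fun i _ => (hφ.measurable_inner m).comp (measurable_pi_apply i)

theorem measurable_kernel_sub (m : H) :
    Measurable fun q : X × X => ⟪φ q.1 - m, φ q.2 - m⟫ := by
  have h : (fun q : X × X => ⟪φ q.1 - m, φ q.2 - m⟫) = fun q =>
      ⟪φ q.1, φ q.2⟫ - ⟪φ q.1, m⟫ - ⟪φ q.2, m⟫ + ⟪m, m⟫ := by
    funext q
    rw [inner_sub_left, inner_sub_right, inner_sub_right, real_inner_comm m (φ q.2)]
    ring
  rw [h]
  exact ((hφ.measurable_kernel.sub ((hφ.measurable_inner m).comp measurable_fst)).sub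
    ((hφ.measurable_inner m).comp measurable_snd)).add_const _

theorem abs_kernel_sub_le {m : H} (hm : ‖m‖ ≤ 1) (x x' : X) :
    |⟪φ x - m, φ x' - m⟫| ≤ 4 := by
  refine (abs_real_inner_le_norm _ _).trans ?_
  have h (x : X) : ‖φ x - m‖ ≤ 2 := by linarith [norm_sub_le (φ x) m, hφ.norm_le x]
  nlinarith [h x, h x', norm_nonneg (φ x - m), norm_nonneg (φ x' - m)]

/-- Fubini: for fixed `x`, the centred feature of the other variable integrates to zero against `φ x
- m`. This removes the off-diagonal terms of the mean squared error. -/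
theorem integral_kernel_sub_prod {ν : Measure X} [IsProbabilityMeasure ν] {m : H}
    (hm : IsWeakMean φ ν m) : ∫ q : X × X, ⟪φ q.1 - m, φ q.2 - m⟫ ∂ν.prod ν = 0 := by
  rw [integral_prod _ (integrable_of_abs_le (hφ.measurable_kernel_sub m) fun q =>
    hφ.abs_kernel_sub_le (hφ.norm_le_one_of_isWeakMean hm) _ _)]
  refine integral_eq_zero_of_ae (ae_of_all _ fun x => ?_)
  simp only [real_inner_comm _ (φ x - m), inner_sub_left _ m (φ x - m), Pi.zero_apply]
  rw [integral_sub (hφ.integrable_inner ν _) (integrable_const _), ← hm (φ x - m)]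
  simp

/-- The integral is at most 1 + ‖m‖² - 2‖m‖² = 1 - ‖m‖², because ‖φ x‖ ≤ 1 and `m` is the weak mean.
-/
theorem integral_kernel_sub_self_le {ν : Measure X} [IsProbabilityMeasure ν] {m : H}
    (hm : IsWeakMean φ ν m) : ∫ x, ⟪φ x - m, φ x - m⟫ ∂ν ≤ 1 := by
  have h (x : X) : ⟪φ x - m, φ x - m⟫ ≤ 1 + (⟪m, m⟫ - 2 * ⟪φ x, m⟫) := by
    rw [real_inner_sub_sub_self, real_inner_self_eq_norm_sq (φ x)]
    nlinarith [hφ.norm_le x, norm_nonneg (φ x)]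
  have hint := (integrable_const (μ := ν) (1 : ℝ)).add
    ((integrable_const (⟪m, m⟫)).sub ((hφ.integrable_inner ν m).const_mul 2))
  refine (integral_mono (integrable_of_abs_le ((hφ.measurable_kernel_sub m).comp
    (measurable_id.prodMk measurable_id)) fun x => hφ.abs_kernel_sub_le
      (hφ.norm_le_one_of_isWeakMean hm) x x) hint h).trans ?_
  have := integral_add (integrable_const (μ := ν) (1 : ℝ))
    ((integrable_const (⟪m, m⟫)).sub ((hφ.integrable_inner ν m).const_mul 2))
  simp only [Pi.sub_apply] at this
  rw [integral_add' (integrable_const (μ := ν) (1 : ℝ))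
    ((integrable_const (⟪m, m⟫)).sub ((hφ.integrable_inner ν m).const_mul 2)),
    integral_sub' (integrable_const _) ((hφ.integrable_inner ν m).const_mul 2),
    integral_const_mul, ← hm m]
  simp only [integral_const, probReal_univ, smul_eq_mul, one_mul]
  linarith [real_inner_self_nonneg (x := m)]

/-- The mean squared error of the sample mean is at most `1 / n`. -/
theorem integral_norm_sampleMean_sub_sq_le {ν : Measure X} [IsProbabilityMeasure ν] {m : H}
    (hm : IsWeakMean φ ν m) {n : ℕ} (hn : n ≠ 0) :
    ∫ z : Fin n → X, ‖sampleMean φ z - m‖ ^ 2 ∂Measure.pi (fun _ => ν) ≤ 1 / n := by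
  have hn' : (n : ℝ) ≠ 0 := by exact_mod_cast hn
  have hm1 := hφ.norm_le_one_of_isWeakMean hm
  have hexp (z : Fin n → X) : ‖sampleMean φ z - m‖ ^ 2 =
      ((n : ℝ)⁻¹ * (n : ℝ)⁻¹) * ∑ i, ∑ j, ⟪φ (z i) - m, φ (z j) - m⟫ := by
    have : sampleMean φ z - m = (n : ℝ)⁻¹ • ∑ i, (φ (z i) - m) := by
      rw [Finset.sum_sub_distrib, smul_sub, sampleMean]
      simp [← Nat.cast_smul_eq_nsmul ℝ, smul_smul, hn']
    rw [← real_inner_self_eq_norm_sq, this]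
    simp only [real_inner_smul_left, real_inner_smul_right, sum_inner, inner_sum, mul_assoc,
      ← Finset.mul_sum]
    rw [Finset.sum_comm]
  have hmeas (i j : Fin n) : Measurable fun z : Fin n → X => ⟪φ (z i) - m, φ (z j) - m⟫ := by
    have hp : Measurable fun z : Fin n → X => (z i, z j) := by fun_prop
    exact (hφ.measurable_kernel_sub m).comp hp
  have hint (i j : Fin n) : Integrable (fun z : Fin n → X => ⟪φ (z i) - m, φ (z j) - m⟫)
      (Measure.pi fun _ => ν) :=
    integrable_of_abs_le (hmeas i j) fun z => hφ.abs_kernel_sub_le hm1 _ _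
  have hlaw (i : Fin n) : (Measure.pi fun _ : Fin n => ν).map (Function.eval i) = ν :=
    (measurePreserving_eval (fun _ : Fin n => ν) i).map_eq
  have hdiag (i : Fin n) :
      ∫ z : Fin n → X, ⟪φ (z i) - m, φ (z i) - m⟫ ∂Measure.pi (fun _ => ν) ≤ 1 := by
    have h := integral_map (μ := Measure.pi fun _ : Fin n => ν) (φ := Function.eval i)
      (measurable_pi_apply i).aemeasurable (f := fun x => ⟪φ x - m, φ x - m⟫)
      (Measurable.aestronglyMeasurable ((hφ.measurable_kernel_sub m).comp
        (measurable_id.prodMk measurable_id)))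
    rw [hlaw] at h
    exact h.symm.trans_le (hφ.integral_kernel_sub_self_le hm)
  have hoff (i j : Fin n) (hij : i ≠ j) :
      ∫ z : Fin n → X, ⟪φ (z i) - m, φ (z j) - m⟫ ∂Measure.pi (fun _ => ν) = 0 := by
    have hind : IndepFun (fun z : Fin n → X => z i) (fun z => z j) (Measure.pi fun _ => ν) :=
      (iIndepFun_pi (μ := fun _ : Fin n => ν) (X := fun _ => id)
        fun _ => aemeasurable_id).indepFun hij
    have hpair := hind.map_prod_eq_prod_map_map (measurable_pi_apply i).aemeasurable
      (measurable_pi_apply j).aemeasurable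
    have hi : (Measure.pi fun _ : Fin n => ν).map (fun z => z i) = ν := hlaw i
    have hj : (Measure.pi fun _ : Fin n => ν).map (fun z => z j) = ν := hlaw j
    rw [hi, hj] at hpair
    have h := integral_map (μ := Measure.pi fun _ : Fin n => ν)
      (φ := fun z : Fin n → X => (z i, z j))
      ((measurable_pi_apply i).prodMk (measurable_pi_apply j)).aemeasurable
      (hφ.measurable_kernel_sub m).aestronglyMeasurable
    rw [hpair, hφ.integral_kernel_sub_prod hm] at h
    exact h.symm
  simp only [hexp]
  rw [integral_const_mul, integral_finsetSum _ fun i _ => integrable_finsetSum _ fun j _ =>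
    hint i j]
  simp only [integral_finsetSum _ fun j _ => hint _ j]
  -- Of the n² terms only the n diagonal ones survive, each at most 1.
  have hsum : ∑ i : Fin n, ∑ j : Fin n,
      ∫ z : Fin n → X, ⟪φ (z i) - m, φ (z j) - m⟫ ∂Measure.pi (fun _ => ν) ≤ n := by
    refine (Finset.sum_le_sum (g := fun _ => (1 : ℝ)) fun i _ => ?_).trans (by simp)
    rw [Finset.sum_eq_single i (fun j _ hj => hoff i j hj.symm) (by simp)]
    exact hdiag i
  refine (mul_le_mul_of_nonneg_left hsum (by positivity)).trans_eq ?_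
  field_simp

theorem integrable_norm_sampleMean_sub_pow {ν : Measure X} [IsProbabilityMeasure ν] {m : H}
    (hm : ‖m‖ ≤ 1) (n k : ℕ) :
    Integrable (fun z : Fin n → X => ‖sampleMean φ z - m‖ ^ k) (Measure.pi fun _ => ν) := by
  refine integrable_of_abs_le (B := 2 ^ k) ((hφ.measurable_norm_sampleMean_sub m).pow_const k)
    fun z => ?_
  rw [abs_pow, abs_norm]
  exact pow_le_pow_left₀ (norm_nonneg _) (hφ.norm_sampleMean_sub_le z hm) k

/-- A Chebyshev bound for the sample mean. -/
theorem measureReal_lt_norm_sampleMean_sub_le {ν : Measure X} [IsProbabilityMeasure ν] {m : H}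
    (hm : IsWeakMean φ ν m) {n : ℕ} (hn : n ≠ 0) {t : ℝ} (ht : 0 < t) :
    (Measure.pi fun _ => ν).real {z : Fin n → X | t < ‖sampleMean φ z - m‖} ≤
      1 / (n * t ^ 2) := by
  have h := mul_meas_ge_le_integral_of_nonneg (μ := Measure.pi fun _ : Fin n => ν)
    (f := fun z => ‖sampleMean φ z - m‖ ^ 2) (ae_of_all _ fun z => by positivity)
    (hφ.integrable_norm_sampleMean_sub_pow (hφ.norm_le_one_of_isWeakMean hm) n 2) (t ^ 2)
  have hsub : (Measure.pi fun _ => ν).real {z : Fin n → X | t < ‖sampleMean φ z - m‖} ≤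
      (Measure.pi fun _ => ν).real {z : Fin n → X | t ^ 2 ≤ ‖sampleMean φ z - m‖ ^ 2} :=
    measureReal_mono fun z hz => pow_le_pow_left₀ ht.le (le_of_lt hz) 2
  refine hsub.trans ?_
  rw [← div_div, le_div_iff₀ (by positivity), mul_comm]
  exact h.trans (hφ.integral_norm_sampleMean_sub_sq_le hm hn)

/-- A sub-Gaussian tail bound for the sample mean. -/
theorem measureReal_le_norm_sampleMean_sub_le {ν : Measure X} [IsProbabilityMeasure ν] {m : H}
    (hm : IsWeakMean φ ν m) {n : ℕ} (hn : n ≠ 0) {t : ℝ} (ht : 0 ≤ t) :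
    (Measure.pi fun _ => ν).real {z : Fin n → X | √(1 / n) + t ≤ ‖sampleMean φ z - m‖} ≤
      Real.exp (-(n * t ^ 2 / 2)) := by
  have hn' : (n : ℝ) ≠ 0 := by exact_mod_cast hn
  have hm1 := hφ.norm_le_one_of_isWeakMean hm
  set f : (Fin n → X) → ℝ := fun z => ‖sampleMean φ z - m‖ with hf
  -- Nonnegativity of the variance gives (E f)² ≤ E f² ≤ 1/n.
  have hmean : ∫ z, f z ∂(Measure.pi fun _ : Fin n => ν) ≤ √(1 / n) := by
    refine Real.le_sqrt_of_sq_le ?_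
    have hmem : MemLp f 2 (Measure.pi fun _ : Fin n => ν) :=
      (memLp_two_iff_integrable_sq (hφ.measurable_norm_sampleMean_sub m).aestronglyMeasurable).2
        (hφ.integrable_norm_sampleMean_sub_pow hm1 n 2)
    have hvar := variance_nonneg f (Measure.pi fun _ : Fin n => ν)
    rw [variance_eq_sub hmem] at hvar
    exact (sub_nonneg.1 hvar).trans (hφ.integral_norm_sampleMean_sub_sq_le hm hn)
  -- With c = 2/n the sub-Gaussian parameter n (c/2)² equals 1/n.
  have hc : HasBoundedDifferences f ((2 / n : NNReal) : ℝ) := by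
    simpa using hφ.hasBoundedDifferences (n := n) m
  have hsg := (hc.hasSubgaussianMGF (ν := ν) (B := 2) (hφ.measurable_norm_sampleMean_sub m)
    fun z => by
      rw [abs_norm]
      exact hφ.norm_sampleMean_sub_le z hm1).measure_ge_le ht
  refine (measureReal_mono fun z hz => ?_).trans (hsg.trans_eq ?_)
  · simp only [Set.mem_ofPred_eq] at hz ⊢
    linarith
  · congr 1
    push_cast
    field_simp

end IsBoundedFeatureMap

end FeatureMap

/-! ### The MMD as a distance between mean embeddings -/

section Embedding

/-- Every function of a reproducing kernel Hilbert space with measurable kernel is measurable. -/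
theorem RKHS.measurable_of_measurable_kerFun {X H : Type*} [MeasurableSpace X]
    [NormedAddCommGroup H] [InnerProductSpace ℝ H] [CompleteSpace H] [RKHS ℝ H X ℝ]
    (hk : ∀ x v, Measurable (RKHS.kerFun H x v)) (h : H) : Measurable h := by
  -- Kernel sections span a dense subspace, and norm convergence implies pointwise convergence, so
  -- measurability passes to the limit.
  have hmem : h ∈ (Submodule.span ℝ {f | ∃ x v, RKHS.kerFun H x v = f}).topologicalClosure := by
    rw [RKHS.kerFun_dense]
    trivial
  obtain ⟨u, hu, hlim⟩ := mem_closure_iff_seq_limit.1 hmem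
  refine measurable_of_tendsto_metrizable (f := fun n => ⇑(u n)) (fun n => ?_)
    (tendsto_pi_nhds.2 fun x => ((RKHS.continuous_eval x).tendsto h).comp hlim)
  refine Submodule.span_induction (p := fun (f : H) _ => Measurable ⇑f) ?_ ?_ ?_ ?_ (hu n)
  · rintro _ ⟨x, v, rfl⟩
    exact hk x v
  · rw [RKHS.coe_zero]
    exact measurable_const
  · intro f g _ _ hf hg
    rw [RKHS.coe_add]
    exact hf.add hg
  · intro c f _ hf
    rw [RKHS.coe_smul]
    exact hf.const_smul c

/-- The integral semimetric of the unit ball of a reproducing kernel Hilbert space is the distance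
between mean embeddings. -/
theorem ABC.ips_unitBall {X H : Type*} [MeasurableSpace X]
    [NormedAddCommGroup H] [InnerProductSpace ℝ H] [CompleteSpace H] [RKHS ℝ H X ℝ]
    {ν₁ ν₂ : Measure X} {m₁ m₂ : H} (h₁ : IsWeakMean (fun x => RKHS.kerFun H x (1 : ℝ)) ν₁ m₁)
    (h₂ : IsWeakMean (fun x => RKHS.kerFun H x (1 : ℝ)) ν₂ m₂) :
    ABC.ips (ABC.unitBall H) ν₁ ν₂ = ENNReal.ofReal ‖m₁ - m₂‖ := by
  have hint (h : H) : ∫ x, h x ∂ν₁ - ∫ x, h x ∂ν₂ = ⟪m₁ - m₂, h⟫ := by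
    rw [inner_sub_left, h₁ h, h₂ h]
    simp
  refine le_antisymm (iSup₂_le ?_) ?_
  · rintro _ ⟨h, hh, rfl⟩
    rw [hint]
    refine ENNReal.ofReal_le_ofReal ((abs_real_inner_le_norm _ _).trans ?_)
    exact mul_le_of_le_one_right (norm_nonneg _) hh
  · set u := m₁ - m₂ with hu
    -- The normalized difference attains the supremum; if `‖u‖ = 0`, the inverse is 0 and the zero
    -- function serves.
    have hball : ⇑(‖u‖⁻¹ • u) ∈ ABC.unitBall H := by
      refine ⟨_, ?_, rfl⟩
      rw [norm_smul, norm_inv, norm_norm]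
      exact inv_mul_le_one
    refine le_trans (le_of_eq ?_) (le_iSup₂_of_le _ hball le_rfl)
    rw [hint, real_inner_smul_right, real_inner_self_eq_norm_mul_norm]
    congr 1
    rcases eq_or_ne ‖u‖ 0 with h0 | h0
    · simp [h0]
    · rw [inv_mul_cancel_left₀ h0, abs_norm]

/-- The maximum mean discrepancy of a bounded measurable kernel is the distance between mean
embeddings for a bounded feature map. -/
theorem ABC.exists_featureMap_mmd.{u} {X : Type u} [MeasurableSpace X] {k : X → X → ℝ}
    (hk_meas : Measurable (Function.uncurry k)) (hk : (Matrix.of k).PosSemidef)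
    (hk_bdd : ∀ x, |k x x| ≤ 1) :
    ∃ (H : Type u) (_ : NormedAddCommGroup H) (_ : InnerProductSpace ℝ H) (_ : CompleteSpace H)
      (φ : X → H), IsBoundedFeatureMap φ ∧ ∀ (ν₁ ν₂ : Measure X) (m₁ m₂ : H),
        IsWeakMean φ ν₁ m₁ → IsWeakMean φ ν₂ m₂ →
          ABC.mmd hk ν₁ ν₂ = ENNReal.ofReal ‖m₁ - m₂‖ := by
  have : Fact (ABC.opKernel k).PosSemidef := ⟨ABC.opKernel_posSemidef hk⟩
  let H := RKHS.OfKernel (ABC.opKernel k)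
  have hker (x y : X) (v : ℝ) : RKHS.kerFun H y v x = k x y * v := by
    rw [RKHS.kerFun_apply, RKHS.OfKernel.kernel_ofKernel]
    simp [ABC.opKernel]
  have hinner (x y : X) :
      ⟪RKHS.kerFun H x (1 : ℝ), RKHS.kerFun H y (1 : ℝ)⟫ = k x y := by
    rw [RKHS.kerFun_inner, hker]
    simp
  have hmeas (h : H) : Measurable h := by
    refine RKHS.measurable_of_measurable_kerFun (fun y v => ?_) h
    have : ⇑(RKHS.kerFun H y v) = fun x => k x y * v := funext fun x => hker x y v
    rw [this]
    exact (hk_meas.comp measurable_prodMk_right).mul_const v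
  refine ⟨H, inferInstance, inferInstance, inferInstance, fun x => RKHS.kerFun H x (1 : ℝ),
    ⟨fun x => ?_, fun h => ?_, ?_⟩, fun ν₁ ν₂ m₁ m₂ h₁ h₂ => ABC.ips_unitBall h₁ h₂⟩
  · have h := real_inner_self_eq_norm_sq (RKHS.kerFun H x (1 : ℝ))
    rw [hinner] at h
    exact (sq_le_one_iff₀ (norm_nonneg _)).1 (h ▸ (le_abs_self _).trans (hk_bdd x))
  · simpa using hmeas h
  · simp only [hinner]
    exact hk_meas

variable {X H : Type*} [MeasurableSpace X] [NormedAddCommGroup H] [InnerProductSpace ℝ H]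

/-- This turns the acceptance event into a condition on the distance between two sample means. -/
theorem IsBoundedFeatureMap.isWeakMean_empirical {φ : X → H} (hφ : IsBoundedFeatureMap φ) {n : ℕ}
    (z : Fin n → X) : IsWeakMean φ (ABC.empirical z) (sampleMean φ z) := by
  intro h
  have hs := (hφ.measurable_inner h).stronglyMeasurable
  rw [ABC.empirical, integral_smul_measure, integral_finsetSum_measure]
  · simp only [integral_dirac' _ _ hs, sampleMean, real_inner_smul_left, sum_inner]
    simp
  · exact fun i _ => hφ.integrable_inner _ h

end Embedding

/-! ### Acceptance probabilities and the ABC posterior -/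

theorem measurable_measure_pi {T X ι : Type*} [Fintype ι] [MeasurableSpace T] [MeasurableSpace X]
    (μ : Kernel T X) [IsMarkovKernel μ] : Measurable fun θ => Measure.pi fun _ : ι => μ θ := by
  refine Measurable.measure_of_isPiSystem_of_isProbabilityMeasure generateFrom_pi.symm
    isPiSystem_pi ?_
  rintro _ ⟨s, hs, rfl⟩
  simp only [Measure.pi_pi]
  exact Finset.measurable_prod _ fun i _ => μ.measurable_coe (hs i trivial)

section Posterior

variable {T X H : Type*} [MeasurableSpace T] [MeasurableSpace X] [NormedAddCommGroup H]
  [InnerProductSpace ℝ H] {φ : X → H} {D : Measure X → Measure X → ℝ≥0∞}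

namespace ABC

theorem measurable_acceptAt (hφ : IsBoundedFeatureMap φ)
    (hD : ∀ (ν₁ ν₂ : Measure X) (m₁ m₂ : H), IsWeakMean φ ν₁ m₁ → IsWeakMean φ ν₂ m₂ →
      D ν₁ ν₂ = ENNReal.ofReal ‖m₁ - m₂‖) (μ : Kernel T X) [IsMarkovKernel μ] (ε : ℝ≥0∞) {n : ℕ}
    (y : Fin n → X) : Measurable (acceptAt D μ ε y) := by
  have hset : MeasurableSet {z : Fin n → X | D (empirical z) (empirical y) ≤ ε} := by
    simp only [hD _ _ _ _ (hφ.isWeakMean_empirical _) (hφ.isWeakMean_empirical y)]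
    exact measurableSet_le (hφ.measurable_norm_sampleMean_sub _).ennreal_ofReal measurable_const
  exact (Measure.measurable_coe hset).comp (measurable_measure_pi μ)

variable {μ : Kernel T X} [IsMarkovKernel μ] {n : ℕ} {y : Fin n → X} {mstar : H} {e r : ℝ}

/-- The triangle inequality through `m` and `mstar` spends r/3 on each sampling error and e + r/3 on
the model. Chebyshev at r/3 fails with probability at most 9/(n r²), hence at most 1/2 once n r² ≥
18. -/
theorem half_le_acceptAt (hφ : IsBoundedFeatureMap φ)
    (hD : ∀ (ν₁ ν₂ : Measure X) (m₁ m₂ : H), IsWeakMean φ ν₁ m₁ → IsWeakMean φ ν₂ m₂ →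
      D ν₁ ν₂ = ENNReal.ofReal ‖m₁ - m₂‖) {θ : T} {m : H} (hm : IsWeakMean φ (μ θ) m)
    (hy : ‖sampleMean φ y - mstar‖ ≤ r / 3) (hθ : ‖m - mstar‖ ≤ e + r / 3) (hr : 0 < r)
    (hn : n ≠ 0) (hnr : 18 ≤ n * r ^ 2) :
    ENNReal.ofReal (1 / 2) ≤ acceptAt D μ (ENNReal.ofReal (e + r)) y θ := by
  have hbad := hφ.measureReal_lt_norm_sampleMean_sub_le hm hn (t := r / 3) (by positivity)
  have hms : MeasurableSet {z : Fin n → X | r / 3 < ‖sampleMean φ z - m‖} :=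
    measurableSet_lt measurable_const (hφ.measurable_norm_sampleMean_sub m)
  have hgood := probReal_compl_eq_one_sub (μ := Measure.pi fun _ : Fin n => μ θ) hms
  have hle : (1 : ℝ) / (n * (r / 3) ^ 2) ≤ 1 / 2 :=
    one_div_le_one_div_of_le (by norm_num) (by nlinarith)
  rw [acceptAt, ENNReal.ofReal_le_iff_le_toReal (measure_ne_top _ _)]
  change _ ≤ (Measure.pi fun _ : Fin n => μ θ).real _
  have hhalf : 1 / 2 ≤ (Measure.pi fun _ : Fin n => μ θ).real
      {z : Fin n → X | r / 3 < ‖sampleMean φ z - m‖}ᶜ := by linarith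
  refine hhalf.trans (measureReal_mono fun z hz => ?_)
  have hz' : ‖sampleMean φ z - m‖ ≤ r / 3 := not_lt.1 hz
  change D _ _ ≤ _
  rw [hD _ _ _ _ (hφ.isWeakMean_empirical z) (hφ.isWeakMean_empirical y)]
  refine ENNReal.ofReal_le_ofReal ?_
  have h1 := norm_sub_le_norm_sub_add_norm_sub (sampleMean φ z) m (sampleMean φ y)
  have h2 := norm_sub_le_norm_sub_add_norm_sub m mstar (sampleMean φ y)
  rw [norm_sub_rev mstar] at h2
  linarith

/-- Acceptance would put `sampleMean φ z` within e + r + r/3 of `mstar`, hence farther than (2 + s)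
r from `m`. The 2r absorbs the mean deviation √(1/n), leaving s r for McDiarmid: this is the origin
of 10/3 = 1 + 1/3 + 2. -/
theorem acceptAt_le (hφ : IsBoundedFeatureMap φ)
    (hD : ∀ (ν₁ ν₂ : Measure X) (m₁ m₂ : H), IsWeakMean φ ν₁ m₁ → IsWeakMean φ ν₂ m₂ →
      D ν₁ ν₂ = ENNReal.ofReal ‖m₁ - m₂‖) {θ : T} {m : H} (hm : IsWeakMean φ (μ θ) m)
    (hy : ‖sampleMean φ y - mstar‖ ≤ r / 3) {s : ℝ} (hs : 0 ≤ s)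
    (hθ : e + (10 / 3 + s) * r < ‖m - mstar‖) (hr : 0 < r) (he : 0 ≤ e)
    (hn : n ≠ 0) (hnr : √(1 / n) ≤ 2 * r) :
    acceptAt D μ (ENNReal.ofReal (e + r)) y θ ≤
      ENNReal.ofReal (Real.exp (-(n * (s * r) ^ 2 / 2))) := by
  rw [acceptAt]
  refine ENNReal.le_ofReal_iff_toReal_le (measure_ne_top _ _) (Real.exp_nonneg _) |>.2 ?_
  refine le_trans (measureReal_mono fun z hz => ?_)
    (hφ.measureReal_le_norm_sampleMean_sub_le hm hn (t := s * r) (by positivity))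
  change D _ _ ≤ _ at hz
  rw [hD _ _ _ _ (hφ.isWeakMean_empirical z) (hφ.isWeakMean_empirical y),
    ENNReal.ofReal_le_ofReal_iff (by positivity)] at hz
  have h1 := norm_sub_le_norm_sub_add_norm_sub m (sampleMean φ z) mstar
  have h2 := norm_sub_le_norm_sub_add_norm_sub (sampleMean φ z) (sampleMean φ y) mstar
  rw [norm_sub_rev m (sampleMean φ z)] at h1
  change √(1 / n) + s * r ≤ ‖sampleMean φ z - m‖
  linarith

/-- Markov's inequality bounds the normalizing constant below by q/2, while the unnormalized mass of
`B` is at most E. -/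
theorem posterior_le (hφ : IsBoundedFeatureMap φ)
    (hD : ∀ (ν₁ ν₂ : Measure X) (m₁ m₂ : H), IsWeakMean φ ν₁ m₁ → IsWeakMean φ ν₂ m₂ →
      D ν₁ ν₂ = ENNReal.ofReal ‖m₁ - m₂‖) {prior : Measure T} [IsProbabilityMeasure prior]
    {ε : ℝ≥0∞} {G B : Set T} {q E : ℝ} (hq : 0 < q) (hG : ENNReal.ofReal q ≤ prior G)
    (hacc : ∀ θ ∈ G, ENNReal.ofReal (1 / 2) ≤ acceptAt D μ ε y θ)
    (hrej : ∀ θ ∈ B, acceptAt D μ ε y θ ≤ ENNReal.ofReal E) :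
    0 < acceptProb D μ prior ε y ∧ posterior D μ prior ε y B ≤ ENNReal.ofReal (2 * E / q) := by
  have hmeas := measurable_acceptAt hφ hD μ ε y
  have hprob : ENNReal.ofReal (q / 2) ≤ acceptProb D μ prior ε y := by
    refine le_trans ?_ (mul_meas_ge_le_lintegral hmeas (ENNReal.ofReal (1 / 2)))
    refine le_trans (le_of_eq ?_) (mul_le_mul_right (hG.trans (measure_mono hacc)) _)
    rw [← ENNReal.ofReal_mul (by norm_num)]
    congr 1
    ring
  have hpos : 0 < ENNReal.ofReal (q / 2) := ENNReal.ofReal_pos.2 (by positivity)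
  refine ⟨hpos.trans_le hprob, ?_⟩
  have hnum : prior.withDensity (acceptAt D μ ε y) B ≤ ENNReal.ofReal E := by
    -- This form holds for every set, as the prior is s-finite; `B` need not be measurable.
    rw [withDensity_apply']
    refine (setLIntegral_mono measurable_const hrej).trans ?_
    rw [setLIntegral_const]
    exact mul_le_of_le_one_right' prob_le_one
  rw [posterior, Measure.smul_apply, smul_eq_mul]
  refine (mul_le_mul' (ENNReal.inv_le_inv.2 hprob) hnum).trans_eq ?_
  rw [← ENNReal.ofReal_inv_of_pos (by positivity), ← ENNReal.ofReal_mul (by positivity)]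
  congr 1
  field_simp

end ABC

end Posterior

/-! ### Rate computation and the observed sample -/

/-- The ratio between the tail of the sample mean and the prior mass at the rate `√(log n / n)`. -/
theorem two_mul_exp_div_le {c L N : ℝ} (hc : 0 < c) (hL : 0 < L) (hN : 0 < N)
    (hlog : 1 ≤ Real.log N) :
    2 * Real.exp (-(N * ((L + 2) ^ (1 / 2 : ℝ) * (Real.log N / N) ^ (1 / 2 : ℝ)) ^ 2 / 2)) /
      (c * ((Real.log N / N) ^ (1 / 2 : ℝ) / 3) ^ L) ≤ 2 * 3 ^ L / (c * N) := by
  have hx : 0 < Real.log N / N := by positivity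
  have hsq {x : ℝ} (hx : 0 ≤ x) : (x ^ (1 / 2 : ℝ)) ^ 2 = x := by
    rw [← Real.sqrt_eq_rpow, Real.sq_sqrt hx]
  have hE : Real.exp (-(N * ((L + 2) ^ (1 / 2 : ℝ) * (Real.log N / N) ^ (1 / 2 : ℝ)) ^ 2 / 2)) =
      N⁻¹ * (1 / N) ^ (1 / 2 * L) := by
    rw [mul_pow, hsq (by positivity), hsq hx.le, Real.rpow_def_of_pos (by positivity),
      Real.log_div one_ne_zero hN.ne', Real.log_one]
    -- The fourth `N` is the one in `N⁻¹`; both sides then become single exponentials.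
    nth_rw 4 [← Real.exp_log hN]
    rw [← Real.exp_neg, ← Real.exp_add]
    congr 1
    field_simp
    ring
  -- The only place where log N ≥ 1 is needed as such.
  have hle : (1 / N) ^ (1 / 2 * L) ≤ ((Real.log N / N) ^ (1 / 2 : ℝ)) ^ L := by
    rw [← Real.rpow_mul hx.le]
    exact Real.rpow_le_rpow (by positivity) (by gcongr) (by positivity)
  rw [hE, Real.div_rpow (x := (Real.log N / N) ^ (1 / 2 : ℝ)) (by positivity) (by norm_num),
    div_le_div_iff₀ (by positivity) (by positivity)]
  calc 2 * (N⁻¹ * (1 / N) ^ (1 / 2 * L)) * (c * N)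
      = 2 * c * (1 / N) ^ (1 / 2 * L) := by field_simp
    _ ≤ 2 * c * ((Real.log N / N) ^ (1 / 2 : ℝ)) ^ L := by gcongr
    _ = _ := by field_simp

section Sample

variable {X H : Type*} [MeasurableSpace X] [NormedAddCommGroup H] [InnerProductSpace ℝ H]

/-- The Chebyshev bound for the sample mean of the first terms of an i.i.d. sequence. -/
theorem IsBoundedFeatureMap.one_sub_le_measure_norm_sampleMean_sub_le {φ : X → H}
    (hφ : IsBoundedFeatureMap φ) {Ω : Type*} [MeasurableSpace Ω] {P : Measure Ω}
    [IsProbabilityMeasure P] {y : ℕ → Ω → X} {ν : Measure X} [IsProbabilityMeasure ν]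
    (hindep : iIndepFun y P) (hlaw : ∀ i, HasLaw (y i) ν P) {m : H} (hm : IsWeakMean φ ν m)
    {n : ℕ} (hn : n ≠ 0) {t : ℝ} (ht : 0 < t) :
    ENNReal.ofReal (1 - 1 / (n * t ^ 2)) ≤
      P {ω | ‖sampleMean φ (fun i : Fin n => y i ω) - m‖ ≤ t} := by
  have hmap : P.map (fun ω (i : Fin n) => y i ω) = Measure.pi fun _ => ν := by
    have h := (iIndepFun_iff_map_fun_eq_pi_map (μ := P) (f := fun (i : Fin n) => y i)
      fun i => (hlaw i).aemeasurable).1 (hindep.precomp Fin.val_injective)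
    rw [h]
    congr 1
    funext i
    exact (hlaw i).map_eq
  have hms : MeasurableSet {z : Fin n → X | t < ‖sampleMean φ z - m‖} :=
    measurableSet_lt measurable_const (hφ.measurable_norm_sampleMean_sub m)
  have hms' : MeasurableSet {z : Fin n → X | ‖sampleMean φ z - m‖ ≤ t} :=
    measurableSet_le (hφ.measurable_norm_sampleMean_sub m) measurable_const
  have hpre := Measure.map_apply_of_aemeasurable (μ := P) (f := fun ω (i : Fin n) => y i ω)
    (aemeasurable_pi_lambda _ fun i => (hlaw i).aemeasurable) hms'
  rw [hmap] at hpre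
  refine le_trans ?_ hpre.le
  have hcompl : {z : Fin n → X | ‖sampleMean φ z - m‖ ≤ t} =
      {z | t < ‖sampleMean φ z - m‖}ᶜ := by
    ext z
    simp
  rw [hcompl, ENNReal.ofReal_le_iff_le_toReal (measure_ne_top _ _)]
  refine le_trans ?_ (probReal_compl_eq_one_sub hms).ge
  linarith [hφ.measureReal_lt_norm_sampleMean_sub_le hm hn ht]

end Sample

end

/-! ### Posterior concentration -/

theorem mainTheorem7 {d p : ℕ}
    -- a bounded positive-definite kernel on `ℝ^d`
    (k : EuclideanSpace ℝ (Fin d) → EuclideanSpace ℝ (Fin d) → ℝ)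
    (hk_meas : Measurable (Function.uncurry k))
    (hk : (Matrix.of k).PosSemidef)
    (hk_bdd : ∀ x, |k x x| ≤ 1)
    -- the statistical model, the prior and the data generating process
    {Θ : Set (EuclideanSpace ℝ (Fin p))}
    (μ : Kernel Θ (EuclideanSpace ℝ (Fin d))) [IsMarkovKernel μ]
    (prior : Measure Θ) [IsProbabilityMeasure prior]
    (μstar : Measure (EuclideanSpace ℝ (Fin d))) [IsProbabilityMeasure μstar]
    -- the observed data are i.i.d. from `μstar`
    {Ω : Type*} [MeasurableSpace Ω] (P : Measure Ω) [IsProbabilityMeasure P]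
    (y : ℕ → Ω → EuclideanSpace ℝ (Fin d))
    (hy_indep : iIndepFun y P) (hy_law : ∀ i, HasLaw (y i) μstar P)
    -- prior mass around the best approximation of `μstar`
    (L c : ℝ) (hL : 0 < L) (hc : 0 < c)
    (hprior : ∀ᶠ ε : ℝ in 𝓝[>] 0, ENNReal.ofReal (c * ε ^ L) ≤
      prior {θ | ABC.mmd hk (μ θ) μstar ≤
        ABC.minDiscrepancy (ABC.mmd hk) μ μstar + ENNReal.ofReal ε}) :
    Tendsto (fun n : ℕ => P {ω |
        0 < ABC.acceptProb (ABC.mmd hk) μ prior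
          (ABC.minDiscrepancy (ABC.mmd hk) μ μstar +
            ENNReal.ofReal ((Real.log n / n) ^ (1 / 2 : ℝ))) (fun i : Fin n => y i ω) ∧
        ABC.posterior (ABC.mmd hk) μ prior
          (ABC.minDiscrepancy (ABC.mmd hk) μ μstar +
            ENNReal.ofReal ((Real.log n / n) ^ (1 / 2 : ℝ))) (fun i : Fin n => y i ω)
          {θ | ABC.minDiscrepancy (ABC.mmd hk) μ μstar +
              ENNReal.ofReal ((10 / 3 + (L + 2) ^ (1 / 2 : ℝ)) *
                (Real.log n / n) ^ (1 / 2 : ℝ)) < ABC.mmd hk (μ θ) μstar}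
          ≤ ENNReal.ofReal (2 * 3 ^ L / (c * n))})
      atTop (𝓝 1) := by
  obtain ⟨H, _, _, _, φ, hφ, hD⟩ := ABC.exists_featureMap_mmd hk_meas hk hk_bdd
  obtain ⟨mstar, hmstar⟩ := hφ.exists_isWeakMean μstar
  choose m hm using fun θ => hφ.exists_isWeakMean (μ θ)
  have hmin : ABC.minDiscrepancy (ABC.mmd hk) μ μstar ≠ ∞ := by
    obtain ⟨θ⟩ : Nonempty Θ := nonempty_of_isProbabilityMeasure prior
    refine ne_top_of_le_ne_top ?_ (iInf_le _ θ)
    rw [hD _ _ _ _ (hm θ) hmstar]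
    exact ENNReal.ofReal_ne_top
  obtain ⟨e, he0, he⟩ : ∃ e : ℝ, 0 ≤ e ∧
      ABC.minDiscrepancy (ABC.mmd hk) μ μstar = ENNReal.ofReal e :=
    ⟨_, ENNReal.toReal_nonneg, (ENNReal.ofReal_toReal hmin).symm⟩
  rw [he] at hprior ⊢
  have hlog : Tendsto (fun n : ℕ => Real.log n) atTop atTop :=
    Real.tendsto_log_atTop.comp tendsto_natCast_atTop_atTop
  have hrate : Tendsto (fun n : ℕ => (Real.log n / n) ^ (1 / 2 : ℝ) / 3) atTop (𝓝 0) := by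
    have h1 : Tendsto (fun n : ℕ => Real.log n / n) atTop (𝓝 0) :=
      (Real.isLittleO_log_id_atTop.tendsto_div_nhds_zero).comp tendsto_natCast_atTop_atTop
    simpa using (h1.rpow_const (p := (1 / 2 : ℝ)) (Or.inr (by norm_num))).div_const 3
  have hpos : ∀ᶠ n : ℕ in atTop, 0 < (Real.log n / n) ^ (1 / 2 : ℝ) / 3 := by
    filter_upwards [hlog.eventually_ge_atTop 1, eventually_gt_atTop 0] with n h1 h2
    have : (0 : ℝ) < n := by exact_mod_cast h2
    positivity
  -- The prior mass condition is applied at radius r/3, whence the factor 3^L.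
  have hprior' := (tendsto_nhdsWithin_iff.2 ⟨hrate, hpos⟩).eventually hprior
  have hlower : Tendsto (fun n : ℕ => ENNReal.ofReal (1 - 9 / Real.log n)) atTop (𝓝 1) := by
    have h := (hlog.const_div_atTop 9).const_sub 1
    simpa using ENNReal.tendsto_ofReal h
  -- The event is only bounded below by a Chebyshev event, so its own measurability plays no role.
  refine tendsto_of_tendsto_of_tendsto_of_le_of_le' hlower tendsto_const_nhds ?_
    (Eventually.of_forall fun n => prob_le_one)
  -- Since n r² = log n, the threshold 18 is the one required by `half_le_acceptAt`; it also gives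
  -- √(1/n) ≤ 2r.
  filter_upwards [hlog.eventually_ge_atTop 18, eventually_ne_atTop 0, hprior'] with n h18 hn hG
  have hnpos : (0 : ℝ) < n := by positivity
  have hx : 0 < Real.log n / n := by positivity
  have hconst := two_mul_exp_div_le hc hL hnpos (by linarith)
  set r := (Real.log n / n) ^ (1 / 2 : ℝ) with hr_def
  have hr : 0 < r := by positivity
  have hr2 : n * r ^ 2 = Real.log n := by
    rw [hr_def, ← Real.sqrt_eq_rpow, Real.sq_sqrt hx.le]
    field_simp
  have hsqrt : √(1 / n) ≤ 2 * r := by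
    refine Real.sqrt_le_iff.2 ⟨by positivity, ?_⟩
    rw [div_le_iff₀ hnpos]
    nlinarith
  refine le_trans (le_of_eq ?_) ((hφ.one_sub_le_measure_norm_sampleMean_sub_le hy_indep hy_law
    hmstar hn (t := r / 3) (by positivity)).trans (measure_mono fun ω hω => ?_))
  · congr 2
    rw [← hr2]
    field_simp
    norm_num
  have hω' : ‖sampleMean φ (fun i : Fin n => y i ω) - mstar‖ ≤ r / 3 := hω
  simp only [Set.mem_ofPred_eq, ← ENNReal.ofReal_add he0 hr.le]
  have h := ABC.posterior_le hφ hD (prior := prior) (μ := μ) (y := fun i : Fin n => y i ω)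
    (ε := ENNReal.ofReal (e + r)) (q := c * (r / 3) ^ L) (by positivity) hG
    (E := Real.exp (-(n * ((L + 2) ^ (1 / 2 : ℝ) * r) ^ 2 / 2)))
    (B := {θ | ENNReal.ofReal e + ENNReal.ofReal ((10 / 3 + (L + 2) ^ (1 / 2 : ℝ)) * r) <
      ABC.mmd hk (μ θ) μstar}) (fun θ hθ => ?_) fun θ hθ => ?_
  · exact ⟨h.1, h.2.trans (ENNReal.ofReal_le_ofReal hconst)⟩
  · rw [Set.mem_ofPred_eq, hD _ _ _ _ (hm θ) hmstar, ← ENNReal.ofReal_add he0 (by positivity),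
      ENNReal.ofReal_le_ofReal_iff (by positivity)] at hθ
    exact ABC.half_le_acceptAt hφ hD (hm θ) hω' hθ hr hn (by linarith)
  · rw [Set.mem_ofPred_eq, hD _ _ _ _ (hm θ) hmstar, ← ENNReal.ofReal_add he0 (by positivity),
      ENNReal.ofReal_lt_ofReal_iff_of_nonneg (by positivity)] at hθ
    exact ABC.acceptAt_le hφ hD (hm θ) hω' (by positivity) hθ hr he0 hn hsqrt
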